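/- **Setting.** Let $E$ be a rate-$1/2$ recursive systematic convolutional encoder over $\mathbb F_2$ with generator matrix $(1, b(D)/a(D))$, $a(0)=1$, $a\neq 1$, realised by a shift register with feedback polynomial $a$ and feedforward polynomial $b$, and with trellis terminated in the zero state. For $x,y\in[0,1]$ let $f_{\mathrm s}(x,y)$ (resp. $f_{\mathrm p}(x,y)$) be its transfer function for the input (resp. parity) bits: the extrinsic erasure probability of the BCJR decoder for an input (resp. parity) bit when the input bits are erased independently with probability $x$ and the parity bits with probability $y$, averaged over the trellis positions, in the limit of infinite trellis length (this limit exists). For $x,\varepsilon\in[0,1]$ put $$f(x;\varepsilon)=\varepsilon\, f_{\mathrm s}(\varepsilon x,\varepsilon),\qquad g(x)=\frac{f_{\mathrm s}(x,x)+f_{\mathrm p}(x,x)}2 .$$ Let $U(x;\varepsilon)=x\,g(x)-\int_0^x g(z)\,dz-\int_0^{g(x)}f(z;\varepsilon)\,dz$, let $u(\varepsilon)=\sup\{\tilde x\in[0,1] : f(g(x);\varepsilon)<x \text{ for all } x\in(0,\tilde x)\}$, and let the potential threshold be $$\varepsilon^*=\sup\Big\{\varepsilon\in[0,1] : u(\varepsilon)>0,\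 \inf_{x\in[u(\varepsilon),1]}U(x;\varepsilon)>0\Big\}.$$ **Density evolution.** Consider the spatially coupled serially concatenated code over the binary erasure channel with erasure probability $\varepsilon$, with coupling memory $m$ and chain positions $t=1,\dots,L$, and with $E$ as inner and as outer encoder. The inner trellis at time $t$ is fed by the positions $t-m,\dots,t$, and the bits at positions outside $1,\dots,L$ are known. Let $p_t^{(i)}$, $t\in\mathbb Z$, be the extrinsic erasure probability of the inner trellis at time $t$ for its input bits. One iteration of density evolution is $$x^{(i)}_t=\frac{\varepsilon}{1+m}\sum_{k=0}^m p^{(i)}_{t+k}\ (1\le t\le L),\qquad p_t^{(i+1)}=f_{\mathrm s}\Big(\frac{\varepsilon}{1+m}\sum_{j=0}^m\frac{a_{t-j}^{(i)}+b_{t-j}^{(i)}}2,\ \varepsilon\Big)\ (t\in\mathbb Z),$$ where $a_t^{(i)}=f_{\mathrm s}(x_t^{(i)},x_t^{(i)})$ and $b_t^{(i)}=f_{\mathrm p}(x_t^{(i)},x_t^{(i)})$ for $1\le t\le L$ are the outputs of the outer trellis, and $x_t^{(i)}=a_t^{(i)}=b_t^{(i)}=0$ for all other $t$. **Claim.** (i)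 The erasure probabilities $x_t^{(i)}$ satisfy the spatially coupled scalar recursion $$x_t^{(i+1)}=\frac1{1+m}\sum_{k=0}^m f\Big(\frac1{1+m}\sum_{j=0}^m g\big(x^{(i)}_{t+j-k}\big);\varepsilon\Big)\quad(1\le t\le L),\qquad x_t^{(i)}=0\ \text{ for all other } t .$$ (ii) (Threshold saturation.) For every $\varepsilon\in[0,1]$ with $\varepsilon<\varepsilon^*$ there is an $m_0$ such that for all $m\ge m_0$ and all $L$, the only fixed point of this scalar recursion with values in $[0,1]$ is $x=0$, and the only fixed point of the density evolution with values in $[0,1]$ is $p=0$. -/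

import Mathlib

open Filter Topology Finset

/-- A rate-1/2 recursive systematic convolutional encoder with generator matrix `(1, b/a)` over
`𝔽₂`, where `a = 1 + ∑ i, feedback i * D ^ (i + 1)` and `b = ∑ i, feedforward i * D ^ i`,
realised as a shift register with `memory` cells. -/
structure RSCEncoder where
  memory : ℕ
  feedback : Fin memory → ZMod 2
  feedforward : Fin (memory + 1) → ZMod 2
  recursive : feedback ≠ 0

namespace RSCEncoder

/-- The content of the shift register; cell `0` is the most recent one. -/
abbrev State (E : RSCEncoder) : Type := Fin E.memory → ZMod 2

/-- The bit that enters the register when the input bit is `b`. -/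
def registerInput (E : RSCEncoder) (s : E.State) (b : ZMod 2) : ZMod 2 :=
  b + ∑ i, E.feedback i * s i

def nextState (E : RSCEncoder) (s : E.State) (b : ZMod 2) : E.State := fun i =>
  if i.val = 0 then E.registerInput s b else s ⟨i.val - 1, by have := i.isLt; omega⟩

/-- The parity bit that is output in state `s` on input `b`. -/
def parity (E : RSCEncoder) (s : E.State) (b : ZMod 2) : ZMod 2 :=
  E.feedforward 0 * E.registerInput s b + ∑ i : Fin E.memory, E.feedforward i.succ * s i

/-- `(u, v)` is a codeword (inputs `u`, parities `v`) of the terminated code with `n` trellis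
sections: it labels a path of the trellis from the zero state to the zero state. -/
def IsCodeword (E : RSCEncoder) (n : ℕ) (u v : Fin n → ZMod 2) : Prop :=
  ∃ s : ℕ → E.State, s 0 = 0 ∧ s n = 0 ∧
    ∀ t : Fin n, s (t + 1) = E.nextState (s t) (u t) ∧ v t = E.parity (s t) (u t)

/-- With `a`, `b` the sets of erased inputs and parities (`true` means erased), the `j`-th input
bit is not determined by the *other* bits that are not erased, that is, the extrinsic output of
the BCJR (optimal symbolwise) decoder for it is an erasure. -/
def InputErased (E : RSCEncoder) (n : ℕ) (j : Fin n) (a b : Fin n → Bool) : Prop :=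
  ∃ u v u' v' : Fin n → ZMod 2, E.IsCodeword n u v ∧ E.IsCodeword n u' v' ∧
    (∀ i, i ≠ j → a i = false → u i = u' i) ∧ (∀ i, b i = false → v i = v' i) ∧ u j ≠ u' j

/-- The same for the `j`-th parity bit. -/
def ParityErased (E : RSCEncoder) (n : ℕ) (j : Fin n) (a b : Fin n → Bool) : Prop :=
  ∃ u v u' v' : Fin n → ZMod 2, E.IsCodeword n u v ∧ E.IsCodeword n u' v' ∧
    (∀ i, a i = false → u i = u' i) ∧ (∀ i, i ≠ j → b i = false → v i = v' i) ∧ v j ≠ v' j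

end RSCEncoder

/-- The probability of the erasure pattern `a` if each bit is erased independently with
probability `x`. -/
noncomputable def patternProb {n : ℕ} (x : ℝ) (a : Fin n → Bool) : ℝ :=
  ∏ i, if a i = true then x else 1 - x

open Classical in
/-- The probability of an event when the inputs are erased with probability `x`, the parities with
probability `y`, all independently. -/
noncomputable def erasureProb {n : ℕ} (x y : ℝ) (P : (Fin n → Bool) → (Fin n → Bool) → Prop) : ℝ :=
  ∑ a, ∑ b, if P a b then patternProb x a * patternProb y b else 0

namespace RSCEncoder

/-- Extrinsic erasure probability of the decoder of the terminated code with `n` sections,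
averaged over the input bits. -/
noncomputable def inputTransferN (E : RSCEncoder) (n : ℕ) (x y : ℝ) : ℝ :=
  (∑ j : Fin n, erasureProb x y (E.InputErased n j)) / n

/-- Extrinsic erasure probability of the decoder of the terminated code with `n` sections,
averaged over the parity bits. -/
noncomputable def parityTransferN (E : RSCEncoder) (n : ℕ) (x y : ℝ) : ℝ :=
  (∑ j : Fin n, erasureProb x y (E.ParityErased n j)) / n

/-- The transfer function `f_s(x, y)` for the input bits, in the limit of infinite block length
(the limit exists, see `tendsto_inputTransfer`). -/
noncomputable def inputTransfer (E : RSCEncoder) (x y : ℝ) : ℝ :=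
  limUnder atTop (fun n => E.inputTransferN n x y)

/-- The transfer function `f_p(x, y)` for the parity bits, in the limit of infinite block length
(the limit exists, see `tendsto_parityTransfer`). -/
noncomputable def parityTransfer (E : RSCEncoder) (x y : ℝ) : ℝ :=
  limUnder atTop (fun n => E.parityTransferN n x y)

end RSCEncoder

section limits

theorem patternProb_nonneg {n : ℕ} {x : ℝ} (hx : x ∈ Set.Icc (0 : ℝ) 1) (a : Fin n → Bool) :
    0 ≤ patternProb x a := by
  refine Finset.prod_nonneg fun i _ => ?_
  split_ifs
  · exact hx.1
  · linarith [hx.2]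

theorem sum_patternProb (n : ℕ) (x : ℝ) : ∑ a : Fin n → Bool, patternProb x a = 1 := by
  unfold patternProb
  rw [← Fintype.prod_sum (fun (_ : Fin n) (c : Bool) => if c = true then x else 1 - x)]
  simp

theorem patternProb_append {m n : ℕ} (x : ℝ) (a : Fin m → Bool) (b : Fin n → Bool) :
    patternProb x (Fin.append a b) = patternProb x a * patternProb x b := by
  simp [patternProb, Fin.prod_univ_add]

theorem erasureProb_le_one {n : ℕ} {x y : ℝ} (hx : x ∈ Set.Icc (0 : ℝ) 1)
    (hy : y ∈ Set.Icc (0 : ℝ) 1) (P : (Fin n → Bool) → (Fin n → Bool) → Prop) :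
    erasureProb x y P ≤ 1 := by
  classical
  calc erasureProb x y P ≤ ∑ a : Fin n → Bool, ∑ b : Fin n → Bool,
        patternProb x a * patternProb y b := by
        unfold erasureProb
        refine Finset.sum_le_sum fun a _ => Finset.sum_le_sum fun b _ => ?_
        split_ifs
        · exact le_rfl
        · exact mul_nonneg (patternProb_nonneg hx a) (patternProb_nonneg hy b)
    _ = 1 := by
        simp_rw [← Finset.mul_sum, sum_patternProb, mul_one]
        exact sum_patternProb n x

theorem sum_append {m n : ℕ} (F : (Fin (m + n) → Bool) → ℝ) :
    ∑ a, F a = ∑ a : Fin m → Bool, ∑ b : Fin n → Bool, F (Fin.append a b) := by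
  rw [← Fintype.sum_prod_type' (f := fun a b => F (Fin.append a b))]
  exact (Fintype.sum_equiv (Fin.appendEquiv m n) _ _ (fun _ => rfl)).symm

theorem erasureProb_le_left {m n : ℕ} {x y : ℝ} (hx : x ∈ Set.Icc (0 : ℝ) 1)
    (hy : y ∈ Set.Icc (0 : ℝ) 1) (P : (Fin m → Bool) → (Fin m → Bool) → Prop)
    (Q : (Fin (m + n) → Bool) → (Fin (m + n) → Bool) → Prop)
    (h : ∀ a b c d, P a b → Q (Fin.append a c) (Fin.append b d)) :
    erasureProb x y P ≤ erasureProb x y Q := by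
  classical
  have key : erasureProb x y P = ∑ a : Fin m → Bool, ∑ c : Fin n → Bool, ∑ b : Fin m → Bool,
      ∑ d : Fin n → Bool, if P a b then
        patternProb x (Fin.append a c) * patternProb y (Fin.append b d) else 0 := by
    unfold erasureProb
    refine Finset.sum_congr rfl fun a _ => ?_
    rw [Finset.sum_comm]
    refine Finset.sum_congr rfl fun b _ => ?_
    by_cases hP : P a b
    · simp only [hP, if_true, patternProb_append]
      have : ∀ c : Fin n → Bool, ∑ d : Fin n → Bool,
          patternProb x a * patternProb x c * (patternProb y b * patternProb y d)
          = patternProb x c * (patternProb x a * patternProb y b) := by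
        intro c
        rw [← Finset.mul_sum, ← Finset.mul_sum, sum_patternProb]
        ring
      simp_rw [this]
      rw [← Finset.sum_mul, sum_patternProb, one_mul]
    · simp [hP]
  rw [key]
  unfold erasureProb
  rw [sum_append]
  simp_rw [sum_append (m := m) (n := n)]
  refine Finset.sum_le_sum fun a _ => Finset.sum_le_sum fun c _ => Finset.sum_le_sum fun b _ =>
    Finset.sum_le_sum fun d _ => ?_
  by_cases hP : P a b
  · rw [if_pos hP, if_pos (h a b c d hP)]
  · rw [if_neg hP]
    split_ifs
    · exact mul_nonneg (patternProb_nonneg hx _) (patternProb_nonneg hy _)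
    · exact le_rfl

theorem erasureProb_le_right {m n : ℕ} {x y : ℝ} (hx : x ∈ Set.Icc (0 : ℝ) 1)
    (hy : y ∈ Set.Icc (0 : ℝ) 1) (P : (Fin n → Bool) → (Fin n → Bool) → Prop)
    (Q : (Fin (m + n) → Bool) → (Fin (m + n) → Bool) → Prop)
    (h : ∀ a b c d, P a b → Q (Fin.append c a) (Fin.append d b)) :
    erasureProb x y P ≤ erasureProb x y Q := by
  classical
  have key : erasureProb x y P = ∑ c : Fin m → Bool, ∑ a : Fin n → Bool, ∑ d : Fin m → Bool,
      ∑ b : Fin n → Bool, if P a b then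
        patternProb x (Fin.append c a) * patternProb y (Fin.append d b) else 0 := by
    rw [Finset.sum_comm]
    unfold erasureProb
    refine Finset.sum_congr rfl fun a _ => ?_
    have hsw : ∀ c : Fin m → Bool, (∑ d : Fin m → Bool, ∑ b : Fin n → Bool, if P a b then
        patternProb x (Fin.append c a) * patternProb y (Fin.append d b) else 0)
        = ∑ b : Fin n → Bool, ∑ d : Fin m → Bool, if P a b then
        patternProb x (Fin.append c a) * patternProb y (Fin.append d b) else 0 :=
      fun c => Finset.sum_comm
    simp_rw [hsw]
    rw [Finset.sum_comm]
    refine Finset.sum_congr rfl fun b _ => ?_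
    by_cases hP : P a b
    · simp only [hP, if_true, patternProb_append]
      have : ∀ c : Fin m → Bool, ∑ d : Fin m → Bool,
          patternProb x c * patternProb x a * (patternProb y d * patternProb y b)
          = patternProb x c * (patternProb x a * patternProb y b) := by
        intro c
        rw [← Finset.mul_sum, ← Finset.sum_mul, sum_patternProb]
        ring
      simp_rw [this]
      rw [← Finset.sum_mul, sum_patternProb, one_mul]
    · simp [hP]
  rw [key]
  unfold erasureProb
  rw [sum_append]
  simp_rw [sum_append (m := m) (n := n)]
  refine Finset.sum_le_sum fun c _ => Finset.sum_le_sum fun a _ => Finset.sum_le_sum fun d _ =>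
    Finset.sum_le_sum fun b _ => ?_
  by_cases hP : P a b
  · rw [if_pos hP, if_pos (h a b c d hP)]
  · rw [if_neg hP]
    split_ifs
    · exact mul_nonneg (patternProb_nonneg hx _) (patternProb_nonneg hy _)
    · exact le_rfl

/-- A superadditive array of erasure probabilities has a limiting average (Fekete). -/
theorem exists_tendsto_average {x y : ℝ} (hx : x ∈ Set.Icc (0 : ℝ) 1) (hy : y ∈ Set.Icc (0 : ℝ) 1)
    (P : ∀ n : ℕ, Fin n → (Fin n → Bool) → (Fin n → Bool) → Prop)
    (hl : ∀ m n j a b c d, P m j a b → P (m + n) (Fin.castAdd n j) (Fin.append a c)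
      (Fin.append b d))
    (hr : ∀ m n j a b c d, P n j a b → P (m + n) (Fin.natAdd m j) (Fin.append c a)
      (Fin.append d b)) :
    ∃ l, Tendsto (fun n : ℕ => (∑ j : Fin n, erasureProb x y (P n j)) / n) atTop (𝓝 l) := by
  have hsub : Subadditive fun n : ℕ => -∑ j : Fin n, erasureProb x y (P n j) := by
    intro m n
    have h1 : ∑ j : Fin m, erasureProb x y (P m j) ≤
        ∑ j : Fin m, erasureProb x y (P (m + n) (Fin.castAdd n j)) :=
      Finset.sum_le_sum fun j _ => erasureProb_le_left hx hy _ _ (hl m n j)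
    have h2 : ∑ j : Fin n, erasureProb x y (P n j) ≤
        ∑ j : Fin n, erasureProb x y (P (m + n) (Fin.natAdd m j)) :=
      Finset.sum_le_sum fun j _ => erasureProb_le_right hx hy _ _ (hr m n j)
    have h3 := Fin.sum_univ_add (fun j => erasureProb x y (P (m + n) j))
    show -∑ j, erasureProb x y (P (m + n) j) ≤
      -∑ j, erasureProb x y (P m j) + -∑ j, erasureProb x y (P n j)
    linarith
  have hb : BddBelow (Set.range fun n : ℕ => (-∑ j : Fin n, erasureProb x y (P n j)) / n) := by
    refine ⟨-1, ?_⟩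
    rintro _ ⟨n, rfl⟩
    have h1 : ∑ j : Fin n, erasureProb x y (P n j) ≤ n := by
      calc _ ≤ ∑ _j : Fin n, (1 : ℝ) :=
            Finset.sum_le_sum fun j _ => erasureProb_le_one hx hy _
        _ = n := by simp
    have h2 : (∑ j : Fin n, erasureProb x y (P n j)) / n ≤ 1 := div_le_one_of_le₀ h1 (by positivity)
    simp only [neg_div]
    linarith
  refine ⟨_, ((hsub.tendsto_lim hb).neg).congr fun n => ?_⟩
  simp [neg_div]

theorem RSCEncoder.isCodeword_zero (E : RSCEncoder) (n : ℕ) : E.IsCodeword n 0 0 :=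
  ⟨fun _ => 0, rfl, rfl, fun t => by
    constructor
    · funext i
      simp [nextState, registerInput]
    · simp [parity, registerInput]⟩

theorem RSCEncoder.IsCodeword.append {E : RSCEncoder} {m n : ℕ} {u v : Fin m → ZMod 2}
    {u' v' : Fin n → ZMod 2} (h : E.IsCodeword m u v) (h' : E.IsCodeword n u' v') :
    E.IsCodeword (m + n) (Fin.append u u') (Fin.append v v') := by
  obtain ⟨s, h0, hm, hs⟩ := h
  obtain ⟨s', h0', hn', hs'⟩ := h'
  refine ⟨fun t => if t < m then s t else s' (t - m), ?_, ?_, ?_⟩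
  · by_cases hm0 : 0 < m
    · simp [hm0, h0]
    · simp [hm0, h0']
  · simp [hn']
  · intro t
    refine Fin.addCases (fun i => ?_) (fun i => ?_) t
    · have hi := i.isLt
      obtain ⟨h1, h2⟩ := hs i
      by_cases hlt : (i : ℕ) + 1 < m
      · simp [hi, hlt, h1, h2]
      · have he : (i : ℕ) + 1 = m := by omega
        rw [he, hm] at h1
        simp only [Fin.val_castAdd, he, lt_irrefl, if_false, hi, if_true, Nat.sub_self, h0',
          Fin.append_left]
        exact ⟨h1, h2⟩
    · obtain ⟨h1, h2⟩ := hs' i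
      have e1 : ¬ (m + (i : ℕ) + 1 < m) := by omega
      have e2 : ¬ (m + (i : ℕ) < m) := by omega
      have e3 : m + (i : ℕ) + 1 - m = i + 1 := by omega
      have e4 : m + (i : ℕ) - m = i := by omega
      simp only [Fin.val_natAdd, e1, e2, e3, e4, if_false, Fin.append_right]
      exact ⟨h1, h2⟩

theorem RSCEncoder.tendsto_inputTransfer (E : RSCEncoder) {x y : ℝ} (hx : x ∈ Set.Icc (0 : ℝ) 1)
    (hy : y ∈ Set.Icc (0 : ℝ) 1) :
    Tendsto (fun n => E.inputTransferN n x y) atTop (𝓝 (E.inputTransfer x y)) := by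
  refine tendsto_nhds_limUnder (exists_tendsto_average hx hy (fun n j => E.InputErased n j) ?_ ?_)
  · rintro m n j a b c d ⟨u, v, u', v', h, h', hu, hv, hj⟩
    refine ⟨_, _, _, _, h.append (E.isCodeword_zero n), h'.append (E.isCodeword_zero n),
      ?_, ?_, by simpa using hj⟩
    · intro i
      refine Fin.addCases (fun i hi ha => ?_) (fun i _ _ => by simp) i
      simp only [Fin.append_left] at ha ⊢
      exact hu i (fun e => hi (by rw [e])) ha
    · intro i
      refine Fin.addCases (fun i ha => ?_) (fun i _ => by simp) i
      simp only [Fin.append_left] at ha ⊢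
      exact hv i ha
  · rintro m n j a b c d ⟨u, v, u', v', h, h', hu, hv, hj⟩
    refine ⟨_, _, _, _, (E.isCodeword_zero m).append h, (E.isCodeword_zero m).append h',
      ?_, ?_, by simpa using hj⟩
    · intro i
      refine Fin.addCases (fun i _ _ => by simp) (fun i hi ha => ?_) i
      simp only [Fin.append_right] at ha ⊢
      exact hu i (fun e => hi (by rw [e])) ha
    · intro i
      refine Fin.addCases (fun i _ => by simp) (fun i ha => ?_) i
      simp only [Fin.append_right] at ha ⊢
      exact hv i ha

theorem RSCEncoder.tendsto_parityTransfer (E : RSCEncoder) {x y : ℝ} (hx : x ∈ Set.Icc (0 : ℝ) 1)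
    (hy : y ∈ Set.Icc (0 : ℝ) 1) :
    Tendsto (fun n => E.parityTransferN n x y) atTop (𝓝 (E.parityTransfer x y)) := by
  refine tendsto_nhds_limUnder (exists_tendsto_average hx hy (fun n j => E.ParityErased n j) ?_ ?_)
  · rintro m n j a b c d ⟨u, v, u', v', h, h', hu, hv, hj⟩
    refine ⟨_, _, _, _, h.append (E.isCodeword_zero n), h'.append (E.isCodeword_zero n),
      ?_, ?_, by simpa using hj⟩
    · intro i
      refine Fin.addCases (fun i ha => ?_) (fun i _ => by simp) i
      simp only [Fin.append_left] at ha ⊢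
      exact hu i ha
    · intro i
      refine Fin.addCases (fun i hi ha => ?_) (fun i _ _ => by simp) i
      simp only [Fin.append_left] at ha ⊢
      exact hv i (fun e => hi (by rw [e])) ha
  · rintro m n j a b c d ⟨u, v, u', v', h, h', hu, hv, hj⟩
    refine ⟨_, _, _, _, (E.isCodeword_zero m).append h, (E.isCodeword_zero m).append h',
      ?_, ?_, by simpa using hj⟩
    · intro i
      refine Fin.addCases (fun i _ => by simp) (fun i ha => ?_) i
      simp only [Fin.append_right] at ha ⊢
      exact hu i ha
    · intro i
      refine Fin.addCases (fun i _ _ => by simp) (fun i hi ha => ?_) i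
      simp only [Fin.append_right] at ha ⊢
      exact hv i (fun e => hi (by rw [e])) ha

end limits

/-! ### Density evolution of the coupled ensemble

The chain has `L` positions `t = 1, …, L`. At each of them there are variable nodes `u_t`, `v_t^O`
and an outer trellis; the inner trellis at time `t` is fed by the positions `t - m, …, t`, so the
inner trellises at the times `1, …, L + m` take part. The bits at positions outside the chain are
known to the decoder (message `0`). A message family `p : ℤ → ℝ` holds the extrinsic erasure
probabilities of the inner trellises (times that take no part carry the message `f_s(0, ε) = 0`). -/

/-- The erasure probability that the outer trellis at time `t` receives from `u_t` and from
`v_t^O`. -/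
noncomputable def toOuter (ε : ℝ) (m L : ℕ) (p : ℤ → ℝ) (t : ℤ) : ℝ :=
  if t ∈ Set.Icc (1 : ℤ) L then ε * ((1 / (1 + (m : ℝ))) * ∑ k ∈ range (m + 1), p (t + k)) else 0

/-- Extrinsic erasure probability from the outer trellis `O` to `u_t`. -/
noncomputable def outerInput (O : RSCEncoder) (L : ℕ) (q : ℤ → ℝ) (t : ℤ) : ℝ :=
  if t ∈ Set.Icc (1 : ℤ) L then O.inputTransfer (q t) (q t) else 0

/-- Extrinsic erasure probability from the outer trellis `O` to `v_t^O`. -/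
noncomputable def outerParity (O : RSCEncoder) (L : ℕ) (q : ℤ → ℝ) (t : ℤ) : ℝ :=
  if t ∈ Set.Icc (1 : ℤ) L then O.parityTransfer (q t) (q t) else 0

/-- The erasure probability that the inner trellis at time `t` receives on its input bits, given
the outputs `ps`, `pp` of the outer trellises. -/
noncomputable def toInner (ε : ℝ) (m : ℕ) (ps pp : ℤ → ℝ) (t : ℤ) : ℝ :=
  ε * ((1 / (1 + (m : ℝ))) * ∑ j ∈ range (m + 1), (ps (t - j) + pp (t - j)) / 2)

/-- One iteration of density evolution for the spatially coupled serially concatenated ensemble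
with outer encoder `O` and inner encoder `I`, as a map on the messages of the inner trellises. -/
noncomputable def scsccStep (O I : RSCEncoder) (ε : ℝ) (m L : ℕ) (p : ℤ → ℝ) : ℤ → ℝ := fun t =>
  let q := toOuter ε m L p
  I.inputTransfer (toInner ε m (outerInput O L q) (outerParity O L q) t) ε

/-! ### The scalar recursions -/

/-- The right-hand side of the spatially coupled scalar recursion with coupling memory `m` on the
chain `1, …, L`, with `x_t = 0` outside the chain. -/
noncomputable def coupledStep (f : ℝ → ℝ → ℝ) (g : ℝ → ℝ) (ε : ℝ) (m L : ℕ) (x : ℤ → ℝ) : ℤ → ℝ :=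
  fun t => if t ∈ Set.Icc (1 : ℤ) L then
    (1 / (1 + (m : ℝ))) * ∑ k ∈ range (m + 1),
      f ((1 / (1 + (m : ℝ))) * ∑ j ∈ range (m + 1), g (x (t + j - k))) ε
  else 0

/-- The potential function `U(x; ε) = x g(x) - G(x) - F(g(x); ε)`. -/
noncomputable def potential (f : ℝ → ℝ → ℝ) (g : ℝ → ℝ) (x ε : ℝ) : ℝ :=
  x * g x - (∫ z in (0 : ℝ)..x, g z) - ∫ z in (0 : ℝ)..(g x), f z ε

/-- The minimum unstable fixed point `u(ε)`. -/
noncomputable def minUnstable (f : ℝ → ℝ → ℝ) (g : ℝ → ℝ) (ε : ℝ) : ℝ :=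
  sSup {y | y ∈ Set.Icc (0 : ℝ) 1 ∧ ∀ x ∈ Set.Ioo (0 : ℝ) y, f (g x) ε < x}

/-- The potential threshold `ε*`. -/
noncomputable def potentialThreshold (f : ℝ → ℝ → ℝ) (g : ℝ → ℝ) : ℝ :=
  sSup {ε | ε ∈ Set.Icc (0 : ℝ) 1 ∧ 0 < minUnstable f g ε ∧
    0 < sInf ((fun x => potential f g x ε) '' Set.Icc (minUnstable f g ε) 1)}

/-- `f(x; ε) = ε f_s(ε x, ε)` for a serially concatenated code with both encoders equal to `E`. -/
noncomputable def sccF (E : RSCEncoder) (x ε : ℝ) : ℝ := ε * E.inputTransfer (ε * x) ε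

/-- `g(x) = (f_s(x, x) + f_p(x, x)) / 2`. -/
noncomputable def sccG (E : RSCEncoder) (x : ℝ) : ℝ :=
  (E.inputTransfer x x + E.parityTransfer x x) / 2

/-!
The transfer functions are monotone (erasing more bits never helps the decoder) and vanish when the
inputs are erased with probability `0` (for the inputs this is where the encoder has to be
recursive: a single nonzero input never leads back to the zero state). Nothing else about
the encoder is needed: no continuity or differentiability of `f` and `g` enters.

Part (i) is a reflection of the two averaging windows together with `g 0 = 0`.

For threshold saturation, choose `ε' > ε` with `U(· ; ε') ≥ δ > 0` on `[u(ε'), 1]`. A fixed point `x`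
for `ε` is a sub-solution `x ≤ T x` for `ε'`, where `T x = A* f (A g x)` with the averaging operators
`(A z)_s = (1 + m)⁻¹ ∑ⱼ z_{s+j}` and `(A* z)_t = (1 + m)⁻¹ ∑ₖ z_{t-k}`. The running maximum
`x̂_t = max_{s ≤ t} x_s` is again a sub-solution, now nondecreasing, and constant equal to `X = max x`
to the right of the chain. With `y = A g x̂`, testing `x̂ ≤ A* f y` against the nonnegative increments
of `g x̂` and moving `A*` to the other side gives
`∑ x̂_t (g(x̂_t) - g(x̂_{t-1})) ≤ ∑ f(y_s) (y_s - y_{s-1})`.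
By Abel summation the left side is at least `X g(X) - ∫₀^X g`; the right side is an upper Riemann
sum of `∫₀^{g(X)} f` with mesh at most `1 / (1 + m)`, so it exceeds that integral by at most
`1 / (1 + m)`. Hence `U(X) ≤ 1 / (1 + m)` (`potential_le_of_monotone`), which for `1 / (1 + m) < δ`
forces `X < u(ε')`. As also `X ≤ f(g(X))`, the definition of `u(ε')` leaves only `X = 0`.
-/

/-! ### Monotonicity of erasure probabilities -/

theorem patternProb_cons {n : ℕ} (x : ℝ) (c : Bool) (a : Fin n → Bool) :
    patternProb x (Fin.cons c a : Fin (n + 1) → Bool) =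
      (if c = true then x else 1 - x) * patternProb x a := by
  simp [patternProb, Fin.prod_univ_succ]

theorem sum_patternProb_mul_succ {n : ℕ} (x : ℝ) (φ : (Fin (n + 1) → Bool) → ℝ) :
    ∑ a, patternProb x a * φ a =
      x * ∑ a : Fin n → Bool, patternProb x a * φ (Fin.cons true a) +
      (1 - x) * ∑ a : Fin n → Bool, patternProb x a * φ (Fin.cons false a) := by
  rw [← (Fin.consEquiv (fun _ : Fin (n + 1) => Bool)).sum_comp, Fintype.sum_prod_type,
    Fintype.sum_bool, Finset.mul_sum, Finset.mul_sum]
  congr 1 <;> refine Finset.sum_congr rfl fun a _ => ?_ <;>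
    simp [Fin.consEquiv, patternProb_cons, mul_assoc]

/-- The expectation of an increasing function of the erasure pattern increases with the erasure
probability. -/
theorem sum_patternProb_mul_mono {n : ℕ} {x x' : ℝ} (hx : x ∈ Set.Icc (0 : ℝ) 1)
    (hx' : x' ∈ Set.Icc (0 : ℝ) 1) (h : x ≤ x') (φ : (Fin n → Bool) → ℝ) (hφ : Monotone φ) :
    ∑ a, patternProb x a * φ a ≤ ∑ a, patternProb x' a * φ a := by
  induction n with
  | zero => simp [patternProb]
  | succ n ih =>
    rw [sum_patternProb_mul_succ, sum_patternProb_mul_succ]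
    have hcons : ∀ c : Bool, Monotone fun a : Fin n → Bool => φ (Fin.cons c a) := fun c a b hab =>
      hφ (Fin.cons_le_cons.2 ⟨le_rfl, hab⟩)
    have h1 := ih _ (hcons true)
    have h2 := ih _ (hcons false)
    have h3 : ∑ a : Fin n → Bool, patternProb x a * φ (Fin.cons false a) ≤
        ∑ a : Fin n → Bool, patternProb x a * φ (Fin.cons true a) :=
      Finset.sum_le_sum fun a _ => mul_le_mul_of_nonneg_left
        (hφ (Fin.cons_le_cons.2 ⟨Bool.false_le _, le_rfl⟩)) (patternProb_nonneg hx a)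
    nlinarith [mul_le_mul_of_nonneg_left h1 hx'.1,
      mul_le_mul_of_nonneg_left h2 (sub_nonneg.2 hx'.2),
      mul_nonneg (sub_nonneg.2 h) (sub_nonneg.2 h3)]

open Classical in
theorem erasureProb_eq {n : ℕ} (x y : ℝ) (P : (Fin n → Bool) → (Fin n → Bool) → Prop) :
    erasureProb x y P =
      ∑ a, patternProb x a * ∑ b, patternProb y b * if P a b then (1 : ℝ) else 0 := by
  unfold erasureProb
  refine Finset.sum_congr rfl fun a _ => ?_
  rw [Finset.mul_sum]
  refine Finset.sum_congr rfl fun b _ => ?_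
  split_ifs <;> simp

theorem erasureProb_nonneg {n : ℕ} {x y : ℝ} (hx : x ∈ Set.Icc (0 : ℝ) 1)
    (hy : y ∈ Set.Icc (0 : ℝ) 1) (P : (Fin n → Bool) → (Fin n → Bool) → Prop) :
    0 ≤ erasureProb x y P := by
  refine Finset.sum_nonneg fun a _ => Finset.sum_nonneg fun b _ => ?_
  split_ifs
  · exact mul_nonneg (patternProb_nonneg hx a) (patternProb_nonneg hy b)
  · exact le_rfl

theorem erasureProb_mono {n : ℕ} {x x' y y' : ℝ} (hx : x ∈ Set.Icc (0 : ℝ) 1)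
    (hx' : x' ∈ Set.Icc (0 : ℝ) 1) (hy : y ∈ Set.Icc (0 : ℝ) 1) (hy' : y' ∈ Set.Icc (0 : ℝ) 1)
    (hxx : x ≤ x') (hyy : y ≤ y') (P : (Fin n → Bool) → (Fin n → Bool) → Prop)
    (hP : ∀ a a' b b', a ≤ a' → b ≤ b' → P a b → P a' b') :
    erasureProb x y P ≤ erasureProb x' y' P := by
  classical
  have hmono : ∀ a a' b b', a ≤ a' → b ≤ b' →
      (if P a b then (1 : ℝ) else 0) ≤ if P a' b' then 1 else 0 := by
    intro a a' b b' ha hb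
    by_cases h : P a b
    · rw [if_pos h, if_pos (hP _ _ _ _ ha hb h)]
    · rw [if_neg h]
      split_ifs <;> norm_num
  rw [erasureProb_eq, erasureProb_eq]
  refine (sum_patternProb_mul_mono hx hx' hxx _ fun a a' ha => ?_).trans ?_
  · exact Finset.sum_le_sum fun b _ =>
      mul_le_mul_of_nonneg_left (hmono _ _ _ _ ha le_rfl) (patternProb_nonneg hy b)
  · exact Finset.sum_le_sum fun a _ => mul_le_mul_of_nonneg_left
      (sum_patternProb_mul_mono hy hy' hyy _ fun b b' hb => hmono _ _ _ _ le_rfl hb)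
      (patternProb_nonneg hx' a)

theorem erasureProb_zero_left {n : ℕ} (y : ℝ) (P : (Fin n → Bool) → (Fin n → Bool) → Prop)
    (hP : ∀ b, ¬ P (fun _ => false) b) : erasureProb 0 y P = 0 := by
  refine Finset.sum_eq_zero fun a _ => Finset.sum_eq_zero fun b _ => ?_
  by_cases ha : ∃ i, a i = true
  · obtain ⟨i, hi⟩ := ha
    have h0 : patternProb 0 a = 0 := Finset.prod_eq_zero (Finset.mem_univ i) (by simp [hi])
    simp [h0]
  · have h0 : a = fun _ => false := funext fun i => by
      simpa using fun h => ha ⟨i, h⟩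
    rw [h0, if_neg (hP b)]

/-! ### Transfer functions -/

namespace RSCEncoder

theorem InputErased.mono {E : RSCEncoder} {n : ℕ} {j : Fin n} {a a' b b' : Fin n → Bool}
    (ha : a ≤ a') (hb : b ≤ b') (h : E.InputErased n j a b) : E.InputErased n j a' b' := by
  obtain ⟨u, v, u', v', hc, hc', hu, hv, hj⟩ := h
  exact ⟨u, v, u', v', hc, hc',
    fun i hi h0 => hu i hi (Bool.eq_false_of_le_false (h0 ▸ ha i)),
    fun i h0 => hv i (Bool.eq_false_of_le_false (h0 ▸ hb i)), hj⟩

theorem ParityErased.mono {E : RSCEncoder} {n : ℕ} {j : Fin n} {a a' b b' : Fin n → Bool}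
    (ha : a ≤ a') (hb : b ≤ b') (h : E.ParityErased n j a b) : E.ParityErased n j a' b' := by
  obtain ⟨u, v, u', v', hc, hc', hu, hv, hj⟩ := h
  exact ⟨u, v, u', v', hc, hc',
    fun i h0 => hu i (Bool.eq_false_of_le_false (h0 ▸ ha i)),
    fun i hi h0 => hv i hi (Bool.eq_false_of_le_false (h0 ▸ hb i)), hj⟩

/-- Trellis paths that start in the same state agree as long as their inputs do. -/
theorem path_eq_of_input_eq {E : RSCEncoder} {n : ℕ} {u u' : Fin n → ZMod 2} {s s' : ℕ → E.State}
    (h0 : s 0 = s' 0) (hs : ∀ t : Fin n, s (t + 1) = E.nextState (s t) (u t))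
    (hs' : ∀ t : Fin n, s' (t + 1) = E.nextState (s' t) (u' t)) {k : ℕ} (hk : k ≤ n)
    (hu : ∀ i : Fin n, (i : ℕ) < k → u i = u' i) : ∀ t ≤ k, s t = s' t := by
  intro t ht
  induction t with
  | zero => exact h0
  | succ t ih =>
    have h1 := hs ⟨t, by omega⟩
    have h2 := hs' ⟨t, by omega⟩
    simp only at h1 h2
    rw [h1, h2, ih (by omega), hu ⟨t, by omega⟩ ht]

/-- Running the register backwards: with equal inputs, the cells up to the last feedback tap `i₀`
agree before the step if they agree after it. -/
theorem cells_eq_of_nextState_cells_eq {E : RSCEncoder} {i₀ : Fin E.memory}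
    (h₀ : E.feedback i₀ ≠ 0) (hlast : ∀ i, i₀ < i → E.feedback i = 0) {s s' : E.State} {b : ZMod 2}
    (h : ∀ i ≤ i₀, E.nextState s b i = E.nextState s' b i) : ∀ i ≤ i₀, s i = s' i := by
  have hlow : ∀ i < i₀, s i = s' i := by
    intro i hi
    have hlt : (i : ℕ) + 1 < E.memory := by
      have := i₀.isLt
      have : (i : ℕ) < i₀ := hi
      omega
    simpa [nextState] using h ⟨i + 1, hlt⟩ (Fin.le_def.2 (Nat.succ_le_of_lt hi))
  have hreg : ∑ i, E.feedback i * (s i - s' i) = 0 := by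
    have hz := h ⟨0, i₀.pos⟩ (Fin.le_def.2 (Nat.zero_le _))
    simp only [nextState, registerInput, if_true, add_right_inj] at hz
    simp only [mul_sub, Finset.sum_sub_distrib, hz, sub_self]
  rw [Finset.sum_eq_single i₀] at hreg
  · intro i hi
    rcases hi.lt_or_eq with hi | rfl
    · exact hlow i hi
    · exact sub_eq_zero.1 ((mul_eq_zero.1 hreg).resolve_left h₀)
  · intro i _ hne
    rcases lt_or_gt_of_ne hne with hi | hi
    · rw [hlow i hi, sub_self, mul_zero]
    · rw [hlast i hi, zero_mul]
  · simp

/-- Two codewords of a recursive encoder never differ in exactly one input bit: the states differ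
right after that bit, and running back from the common final state they agree on the cells that
matter for the feedback. -/
theorem not_inputErased_of_inputs_known (E : RSCEncoder) (n : ℕ) (j : Fin n) (b : Fin n → Bool) :
    ¬ E.InputErased n j (fun _ => false) b := by
  rintro ⟨u, v, u', v', ⟨s, h0, hn, hs⟩, ⟨s', h0', hn', hs'⟩, hu, -, hj⟩
  have hj0 : s j = s' j := path_eq_of_input_eq (h0.trans h0'.symm) (fun t => (hs t).1)
    (fun t => (hs' t).1) j.isLt.le
    (fun i hi => hu i (fun e => by simp [e] at hi) rfl) j le_rfl
  obtain ⟨i₀, h₀, hlast⟩ : ∃ i₀, E.feedback i₀ ≠ 0 ∧ ∀ i, i₀ < i → E.feedback i = 0 := by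
    obtain ⟨i, hi⟩ := Function.ne_iff.1 E.recursive
    obtain ⟨i₀, hm, hmax⟩ := (univ.filter fun i => E.feedback i ≠ 0).exists_max_image id
      ⟨i, by simpa using hi⟩
    refine ⟨i₀, by simpa using hm, fun k hk => ?_⟩
    by_contra hne
    exact absurd (hmax k (by simpa using hne)) (not_le.2 hk)
  have hback : ∀ d : ℕ, (j : ℕ) + 1 + d ≤ n → ∀ i ≤ i₀, s (n - d) i = s' (n - d) i := by
    intro d
    induction d with
    | zero => intro _ i _; rw [Nat.sub_zero, hn, hn']
    | succ d ih =>
      intro hd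
      have ih := ih (by omega)
      have h1 := (hs ⟨n - (d + 1), by omega⟩).1
      have h2 := (hs' ⟨n - (d + 1), by omega⟩).1
      have e : n - (d + 1) + 1 = n - d := by omega
      simp only [e] at h1 h2
      rw [h1, h2, ← hu ⟨n - (d + 1), by omega⟩ (fun e => by
        have := congrArg Fin.val e
        simp only at this
        omega) rfl] at ih
      exact cells_eq_of_nextState_cells_eq h₀ hlast ih
  have hlt := j.isLt
  have hfin := hback (n - (j + 1)) (by omega) ⟨0, i₀.pos⟩ (Fin.le_def.2 (Nat.zero_le _))
  rw [show n - (n - ((j : ℕ) + 1)) = j + 1 by omega, (hs j).1, (hs' j).1, hj0] at hfin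
  simp only [nextState, registerInput, if_true, add_left_inj] at hfin
  exact hj hfin

theorem not_parityErased_of_inputs_known (E : RSCEncoder) (n : ℕ) (j : Fin n) (b : Fin n → Bool) :
    ¬ E.ParityErased n j (fun _ => false) b := by
  rintro ⟨u, v, u', v', ⟨s, h0, hn, hs⟩, ⟨s', h0', hn', hs'⟩, hu, -, hj⟩
  have hj0 : s j = s' j := path_eq_of_input_eq (h0.trans h0'.symm) (fun t => (hs t).1)
    (fun t => (hs' t).1) j.isLt.le (fun i _ => hu i rfl) j le_rfl
  exact hj (by rw [(hs j).2, (hs' j).2, hj0, hu j rfl])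

theorem inputTransfer_zero_left (E : RSCEncoder) (y : ℝ) : E.inputTransfer 0 y = 0 := by
  have h : (fun n => E.inputTransferN n 0 y) = fun _ => 0 := funext fun n => by
    simp [inputTransferN, erasureProb_zero_left y _ (E.not_inputErased_of_inputs_known n _)]
  rw [inputTransfer, h]
  exact tendsto_const_nhds.limUnder_eq

theorem parityTransfer_zero_left (E : RSCEncoder) (y : ℝ) : E.parityTransfer 0 y = 0 := by
  have h : (fun n => E.parityTransferN n 0 y) = fun _ => 0 := funext fun n => by
    simp [parityTransferN, erasureProb_zero_left y _ (E.not_parityErased_of_inputs_known n _)]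
  rw [parityTransfer, h]
  exact tendsto_const_nhds.limUnder_eq

theorem average_erasureProb_mem_Icc {n : ℕ} {x y : ℝ} (hx : x ∈ Set.Icc (0 : ℝ) 1)
    (hy : y ∈ Set.Icc (0 : ℝ) 1) (P : Fin n → (Fin n → Bool) → (Fin n → Bool) → Prop) :
    (∑ j, erasureProb x y (P j)) / n ∈ Set.Icc (0 : ℝ) 1 := by
  refine ⟨div_nonneg (Finset.sum_nonneg fun j _ => erasureProb_nonneg hx hy _) n.cast_nonneg,
    div_le_one_of_le₀ ?_ n.cast_nonneg⟩
  calc _ ≤ ∑ _j : Fin n, (1 : ℝ) := Finset.sum_le_sum fun j _ => erasureProb_le_one hx hy _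
    _ = n := by simp

theorem inputTransfer_mem_Icc (E : RSCEncoder) {x y : ℝ} (hx : x ∈ Set.Icc (0 : ℝ) 1)
    (hy : y ∈ Set.Icc (0 : ℝ) 1) : E.inputTransfer x y ∈ Set.Icc (0 : ℝ) 1 :=
  isClosed_Icc.mem_of_tendsto (E.tendsto_inputTransfer hx hy)
    (Eventually.of_forall fun _ => average_erasureProb_mem_Icc hx hy _)

theorem parityTransfer_mem_Icc (E : RSCEncoder) {x y : ℝ} (hx : x ∈ Set.Icc (0 : ℝ) 1)
    (hy : y ∈ Set.Icc (0 : ℝ) 1) : E.parityTransfer x y ∈ Set.Icc (0 : ℝ) 1 :=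
  isClosed_Icc.mem_of_tendsto (E.tendsto_parityTransfer hx hy)
    (Eventually.of_forall fun _ => average_erasureProb_mem_Icc hx hy _)

theorem inputTransfer_mono (E : RSCEncoder) {x x' y y' : ℝ} (hx : x ∈ Set.Icc (0 : ℝ) 1)
    (hx' : x' ∈ Set.Icc (0 : ℝ) 1) (hy : y ∈ Set.Icc (0 : ℝ) 1) (hy' : y' ∈ Set.Icc (0 : ℝ) 1)
    (hxx : x ≤ x') (hyy : y ≤ y') : E.inputTransfer x y ≤ E.inputTransfer x' y' :=
  le_of_tendsto_of_tendsto' (E.tendsto_inputTransfer hx hy) (E.tendsto_inputTransfer hx' hy')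
    fun n => div_le_div_of_nonneg_right (Finset.sum_le_sum fun _ _ =>
      erasureProb_mono hx hx' hy hy' hxx hyy _ fun _ _ _ _ ha hb => InputErased.mono ha hb)
      n.cast_nonneg

theorem parityTransfer_mono (E : RSCEncoder) {x x' y y' : ℝ} (hx : x ∈ Set.Icc (0 : ℝ) 1)
    (hx' : x' ∈ Set.Icc (0 : ℝ) 1) (hy : y ∈ Set.Icc (0 : ℝ) 1) (hy' : y' ∈ Set.Icc (0 : ℝ) 1)
    (hxx : x ≤ x') (hyy : y ≤ y') : E.parityTransfer x y ≤ E.parityTransfer x' y' :=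
  le_of_tendsto_of_tendsto' (E.tendsto_parityTransfer hx hy) (E.tendsto_parityTransfer hx' hy')
    fun n => div_le_div_of_nonneg_right (Finset.sum_le_sum fun _ _ =>
      erasureProb_mono hx hx' hy hy' hxx hyy _ fun _ _ _ _ ha hb => ParityErased.mono ha hb)
      n.cast_nonneg

end RSCEncoder

theorem sccG_zero (E : RSCEncoder) : sccG E 0 = 0 := by
  simp [sccG, E.inputTransfer_zero_left, E.parityTransfer_zero_left]

theorem sccF_zero_left (E : RSCEncoder) (ε : ℝ) : sccF E 0 ε = 0 := by
  simp [sccF, E.inputTransfer_zero_left]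

theorem sccG_mem_Icc (E : RSCEncoder) {x : ℝ} (hx : x ∈ Set.Icc (0 : ℝ) 1) :
    sccG E x ∈ Set.Icc (0 : ℝ) 1 := by
  have h1 := E.inputTransfer_mem_Icc hx hx
  have h2 := E.parityTransfer_mem_Icc hx hx
  unfold sccG
  constructor <;> linarith [h1.1, h1.2, h2.1, h2.2]

theorem sccG_monotoneOn (E : RSCEncoder) : MonotoneOn (sccG E) (Set.Icc 0 1) := by
  intro x hx x' hx' h
  have h1 := E.inputTransfer_mono hx hx' hx hx' h h
  have h2 := E.parityTransfer_mono hx hx' hx hx' h h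
  unfold sccG
  linarith

theorem sccF_mem_Icc (E : RSCEncoder) {x ε : ℝ} (hx : x ∈ Set.Icc (0 : ℝ) 1)
    (hε : ε ∈ Set.Icc (0 : ℝ) 1) : sccF E x ε ∈ Set.Icc (0 : ℝ) 1 :=
  unitInterval.mul_mem hε (E.inputTransfer_mem_Icc (unitInterval.mul_mem hε hx) hε)

theorem sccF_mono (E : RSCEncoder) {x x' ε ε' : ℝ} (hx : x ∈ Set.Icc (0 : ℝ) 1)
    (hx' : x' ∈ Set.Icc (0 : ℝ) 1) (hε : ε ∈ Set.Icc (0 : ℝ) 1) (hε' : ε' ∈ Set.Icc (0 : ℝ) 1)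
    (hxx : x ≤ x') (hεε : ε ≤ ε') : sccF E x ε ≤ sccF E x' ε' := by
  have hm := unitInterval.mul_mem hε hx
  have hm' := unitInterval.mul_mem hε' hx'
  exact mul_le_mul hεε
    (E.inputTransfer_mono hm hm' hε hε' (mul_le_mul hεε hxx hx.1 hε'.1) hεε)
    (E.inputTransfer_mem_Icc hm hε).1 hε'.1

/-! ### Reduction of density evolution to the scalar recursion -/

/-- Reflecting both averaging windows turns the offsets `k - j` into `j - k`. -/
theorem sum_window_reflect (m : ℕ) (φ : ℝ → ℝ) (z : ℤ → ℝ) (t : ℤ) :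
    ∑ k ∈ range (m + 1), φ (∑ j ∈ range (m + 1), z (t + k - j)) =
      ∑ k ∈ range (m + 1), φ (∑ j ∈ range (m + 1), z (t + j - k)) := by
  rw [← Finset.sum_range_reflect]
  refine Finset.sum_congr rfl fun k hk => ?_
  rw [← Finset.sum_range_reflect]
  congr 1
  refine Finset.sum_congr rfl fun j hj => ?_
  rw [Finset.mem_range] at hk hj
  congr 1
  omega

theorem toOuter_scsccStep (E : RSCEncoder) (ε : ℝ) (m L : ℕ) (p : ℤ → ℝ) :
    toOuter ε m L (scsccStep E E ε m L p) =
      coupledStep (sccF E) (sccG E) ε m L (toOuter ε m L p) := by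
  funext t
  have hg : ∀ t : ℤ, (outerInput E L (toOuter ε m L p) t + outerParity E L (toOuter ε m L p) t) / 2
      = sccG E (toOuter ε m L p t) := by
    intro t
    by_cases ht : t ∈ Set.Icc (1 : ℤ) L
    · simp only [outerInput, outerParity, if_pos ht, sccG]
    · have h0 : toOuter ε m L p t = 0 := if_neg ht
      simp only [outerInput, outerParity, if_neg ht, h0, sccG_zero]
      norm_num
  rw [toOuter, coupledStep]
  split_ifs with ht
  · have hr := sum_window_reflect m
      (fun r => sccF E ((1 / (1 + (m : ℝ))) * r) ε) (fun t => sccG E (toOuter ε m L p t)) t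
    rw [← hr]
    simp only [scsccStep, toInner, hg, sccF, Finset.mul_sum]
    refine Finset.sum_congr rfl fun k _ => ?_
    ring
  · rfl

/-! ### The potential bound for monotone sub-solutions -/

/-- A Riemann sum of a monotone function with left tags is at most the integral. -/
theorem sum_left_le_integral {h : ℝ → ℝ} (hh : MonotoneOn h (Set.Icc 0 1)) {z : ℕ → ℝ}
    (hz : Monotone z) (hz01 : ∀ n, z n ∈ Set.Icc (0 : ℝ) 1) (N : ℕ) :
    ∑ n ∈ range N, h (z n) * (z (n + 1) - z n) ≤ ∫ r in (z 0)..(z N), h r := by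
  have hint : ∀ a b, a ∈ Set.Icc (0 : ℝ) 1 → b ∈ Set.Icc (0 : ℝ) 1 →
      IntervalIntegrable h MeasureTheory.volume a b := fun a b ha hb =>
    (hh.mono (Set.uIcc_subset_Icc ha hb)).intervalIntegrable
  rw [← intervalIntegral.sum_integral_adjacent_intervals
    (fun k _ => hint _ _ (hz01 k) (hz01 (k + 1)))]
  refine Finset.sum_le_sum fun n _ => ?_
  have hle := hz n.le_succ
  calc h (z n) * (z (n + 1) - z n) = ∫ _r in (z n)..(z (n + 1)), h (z n) := by
        simp [mul_comm]
    _ ≤ _ := intervalIntegral.integral_mono_on hle intervalIntegrable_const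
        (hint _ _ (hz01 n) (hz01 (n + 1))) fun r hr =>
          hh (hz01 n) ⟨(hz01 n).1.trans hr.1, hr.2.trans (hz01 (n + 1)).2⟩ hr.1

/-- A Riemann sum of a monotone function with right tags and mesh at most `d` exceeds the integral
by at most `d` times the increase of the function. -/
theorem sum_right_le_integral_add {h : ℝ → ℝ} (hh : MonotoneOn h (Set.Icc 0 1)) {z : ℕ → ℝ}
    (hz : Monotone z) (hz01 : ∀ n, z n ∈ Set.Icc (0 : ℝ) 1) {d : ℝ}
    (hd : ∀ n, z (n + 1) - z n ≤ d) (N : ℕ) :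
    ∑ n ∈ range N, h (z (n + 1)) * (z (n + 1) - z n) ≤
      (∫ r in (z 0)..(z N), h r) + d * (h (z N) - h (z 0)) := by
  have h1 := sum_left_le_integral hh hz hz01 N
  have h2 : ∑ n ∈ range N, (h (z (n + 1)) - h (z n)) * (z (n + 1) - z n) ≤
      ∑ n ∈ range N, (h (z (n + 1)) - h (z n)) * d :=
    Finset.sum_le_sum fun n _ => mul_le_mul_of_nonneg_left (hd n)
      (sub_nonneg.2 (hh (hz01 n) (hz01 (n + 1)) (hz n.le_succ)))
  rw [← Finset.sum_mul, Finset.sum_range_sub (fun n => h (z n))] at h2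
  have h3 : ∑ n ∈ range N, (h (z (n + 1)) - h (z n)) * (z (n + 1) - z n) =
      ∑ n ∈ range N, h (z (n + 1)) * (z (n + 1) - z n) -
      ∑ n ∈ range N, h (z n) * (z (n + 1) - z n) := by
    rw [← Finset.sum_sub_distrib]
    exact Finset.sum_congr rfl fun n _ => by ring
  linarith

/-- Integration by parts for a monotone sequence: `∑ z Δh(z)`, with right tags, is at least
`z h(z) - ∫ h` at the end point. -/
theorem mul_sub_integral_le_sum {h : ℝ → ℝ} (hh : MonotoneOn h (Set.Icc 0 1)) {z : ℕ → ℝ}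
    (hz : Monotone z) (hz01 : ∀ n, z n ∈ Set.Icc (0 : ℝ) 1) (hz0 : z 0 = 0) (N : ℕ) :
    z N * h (z N) - (∫ r in (0 : ℝ)..(z N), h r) ≤
      ∑ n ∈ range N, z (n + 1) * (h (z (n + 1)) - h (z n)) := by
  have h1 := sum_left_le_integral hh hz hz01 N
  have h2 : ∑ n ∈ range N, z (n + 1) * (h (z (n + 1)) - h (z n)) +
      ∑ n ∈ range N, h (z n) * (z (n + 1) - z n) = z N * h (z N) - z 0 * h (z 0) := by
    rw [← Finset.sum_add_distrib, ← Finset.sum_range_sub (fun n => z n * h (z n))]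
    exact Finset.sum_congr rfl fun n _ => by ring
  rw [hz0] at h1 h2
  linarith

/-- Summation against a sequence supported on `1, …, L`, shifted by at most `m`. The index `n`
stands for the position `n + 1 - m`, so that `n < L + m` runs over the positions `1 - m, …, L`. -/
theorem sum_mul_shift (F D : ℤ → ℝ) {m L k : ℕ} (hk : k ≤ m)
    (hD : ∀ t, t ∉ Set.Icc (1 : ℤ) L → D t = 0) :
    ∑ n ∈ range L, F ((n : ℤ) + 1 - k) * D ((n : ℤ) + 1) =
      ∑ n ∈ range (L + m), F ((n : ℤ) + 1 - m) * D ((n : ℤ) + 1 - m + k) := by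
  have hle : m - k + L ≤ L + m := by omega
  rw [← Finset.sum_subset (Finset.range_mono hle), Finset.sum_range_add]
  · rw [Finset.sum_eq_zero (s := range (m - k)), zero_add]
    · refine Finset.sum_congr rfl fun n _ => ?_
      congr 2 <;> push_cast [Nat.cast_sub hk] <;> ring
    · intro n hn
      rw [Finset.mem_range] at hn
      rw [hD, mul_zero]
      rw [Set.mem_Icc]
      omega
  · intro n _ hn
    rw [Finset.mem_range] at hn
    rw [hD, mul_zero]
    rw [Set.mem_Icc]
    omega

theorem average_mem_Icc {m : ℕ} {z : ℕ → ℝ} (hz : ∀ n, z n ∈ Set.Icc (0 : ℝ) 1) :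
    (1 / (1 + (m : ℝ))) * ∑ j ∈ range (m + 1), z j ∈ Set.Icc (0 : ℝ) 1 := by
  have h0 : 0 ≤ ∑ j ∈ range (m + 1), z j := Finset.sum_nonneg fun j _ => (hz j).1
  have h1 : ∑ j ∈ range (m + 1), z j ≤ 1 + (m : ℝ) := by
    calc _ ≤ ∑ _j ∈ range (m + 1), (1 : ℝ) := Finset.sum_le_sum fun j _ => (hz j).2
      _ = 1 + (m : ℝ) := by simp [add_comm]
  refine ⟨by positivity, ?_⟩
  rw [one_div_mul_eq_div]
  exact div_le_one_of_le₀ h1 (by positivity)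

theorem average_mono {m : ℕ} {z z' : ℕ → ℝ} (h : ∀ n, z n ≤ z' n) :
    (1 / (1 + (m : ℝ))) * ∑ j ∈ range (m + 1), z j ≤
      (1 / (1 + (m : ℝ))) * ∑ j ∈ range (m + 1), z' j :=
  mul_le_mul_of_nonneg_left (Finset.sum_le_sum fun j _ => h j) (by positivity)

theorem average_const (m : ℕ) (c : ℝ) :
    (1 / (1 + (m : ℝ))) * ∑ _j ∈ range (m + 1), c = c := by
  have : (1 + (m : ℝ)) ≠ 0 := by positivity
  simp only [Finset.sum_const, Finset.card_range, nsmul_eq_mul]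
  push_cast
  field_simp
  ring

/-- The value `X` that a monotone sub-solution of the one-sided coupled recursion reaches to the
right of the chain has potential at most `1 / (1 + m)`. -/
theorem potential_le_of_monotone {f : ℝ → ℝ → ℝ} {g : ℝ → ℝ} {ε : ℝ}
    (hf : MonotoneOn (fun r => f r ε) (Set.Icc 0 1))
    (hf01 : ∀ r ∈ Set.Icc (0 : ℝ) 1, f r ε ∈ Set.Icc (0 : ℝ) 1)
    (hg : MonotoneOn g (Set.Icc 0 1)) (hg01 : ∀ r ∈ Set.Icc (0 : ℝ) 1, g r ∈ Set.Icc (0 : ℝ) 1)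
    (hg0 : g 0 = 0) {m L : ℕ} {x : ℤ → ℝ} (hx : Monotone x) (hx01 : ∀ t, x t ∈ Set.Icc (0 : ℝ) 1)
    {X : ℝ} (hleft : ∀ t ≤ 0, x t = 0) (hright : ∀ t : ℤ, (L : ℤ) ≤ t → x t = X)
    (hsub : ∀ t, x t ≤ (1 / (1 + (m : ℝ))) * ∑ k ∈ range (m + 1),
      f ((1 / (1 + (m : ℝ))) * ∑ j ∈ range (m + 1), g (x (t + j - k))) ε) :
    potential f g X ε ≤ 1 / (1 + (m : ℝ)) := by
  set y : ℤ → ℝ := fun s => (1 / (1 + (m : ℝ))) * ∑ j ∈ range (m + 1), g (x (s + j)) with hy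
  set D : ℤ → ℝ := fun t => g (x t) - g (x (t - 1)) with hD
  have hgx : Monotone fun t => g (x t) := fun s t hst => hg (hx01 s) (hx01 t) (hx hst)
  have hy01 : ∀ s, y s ∈ Set.Icc (0 : ℝ) 1 := fun s => average_mem_Icc fun j => hg01 _ (hx01 _)
  have hymono : Monotone y := fun s t hst => average_mono fun j => hgx (by omega)
  have hDnonneg : ∀ t, 0 ≤ D t := fun t => sub_nonneg.2 (hgx (by omega))
  have hDzero : ∀ t, t ∉ Set.Icc (1 : ℤ) L → D t = 0 := by
    intro t ht
    rw [Set.mem_Icc, not_and_or, not_le, not_le] at ht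
    rcases ht with ht | ht
    · simp only [hD, hleft t (by omega), hleft (t - 1) (by omega), sub_self]
    · simp only [hD, hright t (by omega), hright (t - 1) (by omega), sub_self]
  have hydiff : ∀ s, y s - y (s - 1) = (1 / (1 + (m : ℝ))) * ∑ k ∈ range (m + 1), D (s + k) := by
    intro s
    simp only [hy, hD]
    rw [← mul_sub, ← Finset.sum_sub_distrib]
    congr 1
    refine Finset.sum_congr rfl fun j _ => ?_
    rw [show s - 1 + (j : ℤ) = s + j - 1 by ring]
  -- The increments telescope within the window, so the mesh of `y` is at most `1 / (1 + m)`.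
  have hmesh : ∀ s, y s - y (s - 1) ≤ 1 / (1 + (m : ℝ)) := by
    intro s
    rw [hydiff]
    have htel : ∑ k ∈ range (m + 1), D (s + k) = g (x (s + m)) - g (x (s - 1)) := by
      have := Finset.sum_range_sub (fun k : ℕ => g (x (s + k - 1))) (m + 1)
      simp only [Nat.cast_zero, add_zero] at this
      rw [show s + ((m + 1 : ℕ) : ℤ) - 1 = s + m by push_cast; ring] at this
      rw [← this]
      refine Finset.sum_congr rfl fun k _ => ?_
      simp only [hD]
      rw [show s + ((k + 1 : ℕ) : ℤ) - 1 = s + k by push_cast; ring]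
    rw [htel]
    have h1 := (hg01 _ (hx01 (s + m))).2
    have h2 := (hg01 _ (hx01 (s - 1))).1
    exact mul_le_of_le_one_right (by positivity) (by linarith)
  have hparts := mul_sub_integral_le_sum hg (z := fun n : ℕ => x n)
    (fun a b hab => hx (by exact_mod_cast hab)) (fun n => hx01 n) (hleft 0 le_rfl) L
  -- Test the sub-solution property against the increments `D`, then sum over `t` before `k`.
  have htest : ∑ n ∈ range L, x ((n + 1 : ℕ) : ℤ) * (g (x ((n + 1 : ℕ) : ℤ)) - g (x n)) ≤
      ∑ n ∈ range (L + m), f (y ((n : ℤ) + 1 - m)) ε *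
        (y ((n : ℤ) + 1 - m) - y ((n : ℤ) + 1 - m - 1)) := by
    calc ∑ n ∈ range L, x ((n + 1 : ℕ) : ℤ) * (g (x ((n + 1 : ℕ) : ℤ)) - g (x n))
        ≤ ∑ n ∈ range L, ((1 / (1 + (m : ℝ))) * ∑ k ∈ range (m + 1),
            f (y ((n : ℤ) + 1 - k)) ε) * D ((n : ℤ) + 1) := by
          refine Finset.sum_le_sum fun n _ => ?_
          have hDn : g (x ((n + 1 : ℕ) : ℤ)) - g (x n) = D ((n : ℤ) + 1) := by
            simp [hD]
          rw [hDn]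
          refine mul_le_mul_of_nonneg_right ((hsub _).trans_eq ?_) (hDnonneg _)
          congr 1
          refine Finset.sum_congr rfl fun k _ => ?_
          simp only [hy]
          congr 2
          refine Finset.sum_congr rfl fun j _ => ?_
          congr 2
          push_cast
          ring
      _ = (1 / (1 + (m : ℝ))) * ∑ k ∈ range (m + 1), ∑ n ∈ range L,
            f (y ((n : ℤ) + 1 - k)) ε * D ((n : ℤ) + 1) := by
          rw [Finset.sum_comm, Finset.mul_sum]
          refine Finset.sum_congr rfl fun n _ => ?_
          rw [mul_assoc, Finset.sum_mul]
      _ = (1 / (1 + (m : ℝ))) * ∑ k ∈ range (m + 1), ∑ n ∈ range (L + m),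
            f (y ((n : ℤ) + 1 - m)) ε * D ((n : ℤ) + 1 - m + k) := by
          congr 1
          refine Finset.sum_congr rfl fun k hk => ?_
          rw [Finset.mem_range] at hk
          exact sum_mul_shift (fun s => f (y s) ε) D (by omega) hDzero
      _ = _ := by
          rw [Finset.sum_comm, Finset.mul_sum]
          refine Finset.sum_congr rfl fun n _ => ?_
          rw [hydiff, ← Finset.mul_sum]
          ring
  have hriem := sum_right_le_integral_add hf (z := fun n : ℕ => y ((n : ℤ) - m))
    (fun a b hab => hymono (by omega)) (fun n => hy01 _) (d := 1 / (1 + (m : ℝ)))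
    (fun n => by
      have := hmesh ((n : ℤ) + 1 - m)
      rw [show (n : ℤ) + 1 - m - 1 = n - m by ring] at this
      push_cast
      exact this) (L + m)
  have hyleft : y (((0 : ℕ) : ℤ) - m) = 0 := by
    simp only [hy]
    rw [Finset.sum_eq_zero, mul_zero]
    intro j hj
    rw [Finset.mem_range] at hj
    rw [hleft _ (by omega), hg0]
  have hyright : y (((L + m : ℕ) : ℤ) - m) = g X := by
    simp only [hy]
    rw [← average_const m (g X)]
    congr 1
    refine Finset.sum_congr rfl fun j _ => ?_
    rw [hright _ (by omega)]
  have hgX : g X ∈ Set.Icc (0 : ℝ) 1 := hyright ▸ hy01 _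
  simp only [hyleft, hyright] at hriem
  have hsame : ∑ n ∈ range (L + m), f (y (((n + 1 : ℕ) : ℤ) - m)) ε *
        (y (((n + 1 : ℕ) : ℤ) - m) - y ((n : ℤ) - m)) =
      ∑ n ∈ range (L + m), f (y ((n : ℤ) + 1 - m)) ε *
        (y ((n : ℤ) + 1 - m) - y ((n : ℤ) + 1 - m - 1)) := by
    refine Finset.sum_congr rfl fun n _ => ?_
    rw [show (n : ℤ) + 1 - m - 1 = n - m by ring]
    push_cast
    rfl
  rw [hsame] at hriem
  have hgap : (1 / (1 + (m : ℝ))) * (f (g X) ε - f 0 ε) ≤ 1 / (1 + (m : ℝ)) := by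
    have h1 := (hf01 _ hgX).2
    have h2 := (hf01 0 ⟨le_rfl, zero_le_one⟩).1
    exact mul_le_of_le_one_right (by positivity) (by linarith)
  simp only [hright (L : ℤ) le_rfl] at hparts
  unfold potential
  linarith

/-! ### Threshold saturation -/

/-- Sub-solutions of the coupled recursion vanish once the coupling memory is large compared with
the inverse of the potential gap: the running maximum of a sub-solution is a monotone one. -/
theorem eq_zero_of_le_coupledStep {f : ℝ → ℝ → ℝ} {g : ℝ → ℝ} {ε : ℝ}
    (hf : MonotoneOn (fun r => f r ε) (Set.Icc 0 1))
    (hf01 : ∀ r ∈ Set.Icc (0 : ℝ) 1, f r ε ∈ Set.Icc (0 : ℝ) 1)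
    (hg : MonotoneOn g (Set.Icc 0 1)) (hg01 : ∀ r ∈ Set.Icc (0 : ℝ) 1, g r ∈ Set.Icc (0 : ℝ) 1)
    (hg0 : g 0 = 0) {m L : ℕ}
    (hgap : 1 / (1 + (m : ℝ)) <
      sInf ((fun r => potential f g r ε) '' Set.Icc (minUnstable f g ε) 1))
    {x : ℤ → ℝ} (hx01 : ∀ t, x t ∈ Set.Icc (0 : ℝ) 1)
    (hsub : ∀ t, x t ≤ coupledStep f g ε m L x t) : x = 0 := by
  have hout : ∀ t, t ∉ Set.Icc (1 : ℤ) L → x t = 0 := fun t ht =>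
    le_antisymm ((hsub t).trans_eq (if_neg ht)) (hx01 t).1
  have hbdd : ∀ t : ℤ, BddAbove (Set.range fun s : Set.Iic t => x s) := fun t =>
    ⟨1, by rintro _ ⟨s, rfl⟩; exact (hx01 s).2⟩
  have hne : ∀ t : ℤ, Nonempty (Set.Iic t) := fun t => ⟨⟨t, Set.mem_Iic.2 le_rfl⟩⟩
  set M : ℤ → ℝ := fun t => ⨆ s : Set.Iic t, x s with hM
  have hxM : ∀ s t, s ≤ t → x s ≤ M t := fun s t hst => le_ciSup (hbdd t) ⟨s, hst⟩
  have hMle : ∀ t c, (∀ s ≤ t, x s ≤ c) → M t ≤ c := fun t c h =>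
    haveI := hne t
    ciSup_le fun s => h s s.2
  have hMmono : Monotone M := fun s t hst => hMle s _ fun r hr => hxM r t (hr.trans hst)
  have hM01 : ∀ t, M t ∈ Set.Icc (0 : ℝ) 1 := fun t =>
    ⟨(hx01 t).1.trans (hxM t t le_rfl), hMle t 1 fun s _ => (hx01 s).2⟩
  have hleft : ∀ t ≤ 0, M t = 0 := fun t ht => le_antisymm
    (hMle t 0 fun s hs => (hout s fun h => by have := h.1; omega).le) (hM01 t).1
  have hright : ∀ t : ℤ, (L : ℤ) ≤ t → M t = M L := by
    intro t ht
    refine le_antisymm (hMle t _ fun s _ => ?_) (hMmono ht)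
    by_cases hs : s ≤ L
    · exact hxM s L hs
    · rw [hout s fun h => hs h.2]
      exact (hM01 L).1
  have havg : ∀ {z : ℤ → ℝ} (_ : ∀ t, z t ∈ Set.Icc (0 : ℝ) 1) (s k : ℤ),
      (1 / (1 + (m : ℝ))) * ∑ j ∈ range (m + 1), g (z (s + j - k)) ∈ Set.Icc (0 : ℝ) 1 :=
    fun hz s k => average_mem_Icc (z := fun j => g _) fun j => hg01 _ (hz _)
  have hMsub : ∀ t, M t ≤ (1 / (1 + (m : ℝ))) * ∑ k ∈ range (m + 1),
      f ((1 / (1 + (m : ℝ))) * ∑ j ∈ range (m + 1), g (M (t + j - k))) ε := by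
    intro t
    refine hMle t _ fun s hs => ?_
    by_cases hsL : s ∈ Set.Icc (1 : ℤ) L
    · have h1 := hsub s
      rw [coupledStep, if_pos hsL] at h1
      refine h1.trans (average_mono fun k => hf (havg hx01 _ _) (havg hM01 _ _)
        (average_mono fun j => hg (hx01 _) (hM01 _) (hxM _ _ (by omega))))
    · rw [hout s hsL]
      exact (average_mem_Icc fun k => hf01 _ (havg hM01 _ _)).1
  have hpot := potential_le_of_monotone hf hf01 hg hg01 hg0 hMmono hM01 hleft hright hMsub
  have hpos : (0 : ℝ) < 1 / (1 + (m : ℝ)) := by positivity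
  have hlt : M L < minUnstable f g ε := by
    by_contra hge
    -- An unbounded set would have the junk infimum `0`.
    have hbb : BddBelow ((fun r => potential f g r ε) '' Set.Icc (minUnstable f g ε) 1) := by
      by_contra hb
      rw [Real.sInf_of_not_bddBelow hb] at hgap
      exact hgap.not_gt hpos
    have := csInf_le hbb (Set.mem_image_of_mem (fun r => potential f g r ε)
      ⟨not_lt.1 hge, (hM01 L).2⟩)
    exact (this.trans hpot).not_gt hgap
  have hfix : M L ≤ f (g (M L)) ε := by
    have hgM : g (M L) ∈ Set.Icc (0 : ℝ) 1 := hg01 _ (hM01 L)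
    have hle : ∀ t, M t ≤ M L := fun t => by
      rcases le_total t L with h | h
      · exact hMmono h
      · exact (hright t h).le
    calc M L ≤ _ := hMsub L
      _ ≤ (1 / (1 + (m : ℝ))) * ∑ k ∈ range (m + 1), f (g (M L)) ε := by
        refine average_mono fun k => hf (havg hM01 _ _) hgM ?_
        calc _ ≤ (1 / (1 + (m : ℝ))) * ∑ j ∈ range (m + 1), g (M L) :=
              average_mono fun j => hg (hM01 _) (hM01 _) (hle _)
          _ = g (M L) := average_const m _
      _ = f (g (M L)) ε := average_const m _
  have hML : M L = 0 := by
    by_contra hne0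
    obtain ⟨y, hy, hly⟩ := exists_lt_of_lt_csSup
      (⟨0, ⟨le_rfl, zero_le_one⟩, by simp⟩ :
        {y | y ∈ Set.Icc (0 : ℝ) 1 ∧ ∀ x ∈ Set.Ioo (0 : ℝ) y, f (g x) ε < x}.Nonempty) hlt
    exact (hy.2 (M L) ⟨lt_of_le_of_ne (hM01 L).1 (Ne.symm hne0), hly⟩).not_ge hfix
  funext t
  by_cases ht : t ∈ Set.Icc (1 : ℤ) L
  · exact le_antisymm ((hxM t L ht.2).trans_eq hML) (hx01 t).1
  · exact hout t ht

/-- The coupled recursion is monotone in the channel parameter. -/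
theorem coupledStep_mono_right (E : RSCEncoder) {ε ε' : ℝ} (hε : ε ∈ Set.Icc (0 : ℝ) 1)
    (hε' : ε' ∈ Set.Icc (0 : ℝ) 1) (h : ε ≤ ε') (m L : ℕ) {x : ℤ → ℝ}
    (hx : ∀ t, x t ∈ Set.Icc (0 : ℝ) 1) (t : ℤ) :
    coupledStep (sccF E) (sccG E) ε m L x t ≤ coupledStep (sccF E) (sccG E) ε' m L x t := by
  unfold coupledStep
  split_ifs
  · refine average_mono fun k => ?_
    have hm : (1 / (1 + (m : ℝ))) * ∑ j ∈ range (m + 1), sccG E (x (t + j - k)) ∈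
        Set.Icc (0 : ℝ) 1 := average_mem_Icc fun j => sccG_mem_Icc E (hx _)
    exact sccF_mono E hm hm hε hε' le_rfl h
  · exact le_rfl

theorem coupledStep_zero (E : RSCEncoder) (ε : ℝ) (m L : ℕ) :
    coupledStep (sccF E) (sccG E) ε m L 0 = 0 := by
  funext t
  simp [coupledStep, sccG_zero, sccF_zero_left]

theorem toOuter_mem_Icc {ε : ℝ} (hε : ε ∈ Set.Icc (0 : ℝ) 1) (m L : ℕ) {p : ℤ → ℝ}
    (hp : ∀ t, p t ∈ Set.Icc (0 : ℝ) 1) (t : ℤ) : toOuter ε m L p t ∈ Set.Icc (0 : ℝ) 1 := by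
  unfold toOuter
  split_ifs
  · exact unitInterval.mul_mem hε (average_mem_Icc fun k => hp _)
  · exact ⟨le_rfl, zero_le_one⟩

/-- If the outer trellises receive no erasures, the inner ones produce none. -/
theorem scsccStep_eq_zero (E : RSCEncoder) (ε : ℝ) (m L : ℕ) {p : ℤ → ℝ}
    (hq : toOuter ε m L p = 0) : scsccStep E E ε m L p = 0 := by
  funext t
  simp [scsccStep, hq, toInner, outerInput, outerParity, E.inputTransfer_zero_left,
    E.parityTransfer_zero_left]

theorem mainTheorem3 (E : RSCEncoder) :
    (∀ (ε : ℝ) (m L : ℕ) (p : ℤ → ℝ),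
      toOuter ε m L (scsccStep E E ε m L p) =
        coupledStep (sccF E) (sccG E) ε m L (toOuter ε m L p)) ∧
    (∀ ε ∈ Set.Icc (0 : ℝ) 1, ε < potentialThreshold (sccF E) (sccG E) →
      ∃ m₀ : ℕ, ∀ m ≥ m₀, ∀ L : ℕ,
        (∀ x : ℤ → ℝ, (∀ t, x t ∈ Set.Icc (0 : ℝ) 1) →
          (coupledStep (sccF E) (sccG E) ε m L x = x ↔ x = 0)) ∧
        (∀ p : ℤ → ℝ, (∀ t, p t ∈ Set.Icc (0 : ℝ) 1) →
          (scsccStep E E ε m L p = p ↔ p = 0))) := by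
  refine ⟨toOuter_scsccStep E, fun ε hε hlt => ?_⟩
  obtain ⟨ε', hε', hεε', hgap⟩ : ∃ ε' ∈ Set.Icc (0 : ℝ) 1, ε < ε' ∧
      0 < sInf ((fun x => potential (sccF E) (sccG E) x ε') ''
        Set.Icc (minUnstable (sccF E) (sccG E) ε') 1) := by
    -- The supremum of an empty set would be `0`, which does not exceed `ε`.
    have hne : {ε | ε ∈ Set.Icc (0 : ℝ) 1 ∧ 0 < minUnstable (sccF E) (sccG E) ε ∧
        0 < sInf ((fun x => potential (sccF E) (sccG E) x ε) ''
          Set.Icc (minUnstable (sccF E) (sccG E) ε) 1)}.Nonempty := by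
      rw [Set.nonempty_iff_ne_empty]
      intro h
      rw [potentialThreshold, h, Real.sSup_empty] at hlt
      exact hlt.not_ge hε.1
    obtain ⟨ε', h, hlt'⟩ := exists_lt_of_lt_csSup hne hlt
    exact ⟨ε', h.1, hlt', h.2.2⟩
  obtain ⟨m₀, hm₀⟩ := exists_nat_one_div_lt hgap
  refine ⟨m₀, fun m hm L => ?_⟩
  have hfixed : ∀ x : ℤ → ℝ, (∀ t, x t ∈ Set.Icc (0 : ℝ) 1) →
      coupledStep (sccF E) (sccG E) ε m L x = x → x = 0 := by
    intro x hx hfix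
    refine eq_zero_of_le_coupledStep (f := sccF E) (ε := ε') (m := m) (L := L)
      (fun r hr r' hr' h => sccF_mono E hr hr' hε' hε' h le_rfl)
      (fun r hr => sccF_mem_Icc E hr hε') (sccG_monotoneOn E) (fun r hr => sccG_mem_Icc E hr)
      (sccG_zero E) (lt_of_le_of_lt ?_ hm₀) hx fun t => ?_
    · rw [add_comm]
      gcongr
    · calc x t = coupledStep (sccF E) (sccG E) ε m L x t := by rw [hfix]
        _ ≤ _ := coupledStep_mono_right E hε hε' hεε'.le m L hx t
  refine ⟨fun x hx => ⟨hfixed x hx, ?_⟩, fun p hp => ⟨fun hfix => ?_, ?_⟩⟩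
  · rintro rfl
    exact coupledStep_zero E ε m L
  · have hq : toOuter ε m L p = 0 := hfixed _ (toOuter_mem_Icc hε m L hp) (by
      rw [← toOuter_scsccStep, hfix])
    rw [← hfix]
    exact scsccStep_eq_zero E ε m L hq
  · rintro rfl
    exact scsccStep_eq_zero E ε m L (by funext t; simp [toOuter])
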